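/- Let $\mathbf P$ be any set of propositional variables. The language $\mathcal L(\blacktriangle)$ is given by $\phi ::= \top \mid p \mid \neg\phi \mid (\phi\wedge\phi) \mid \blacktriangle\phi$ with $p\in\mathbf P$. It is interpreted in models $\mathcal M=\langle S,R,V\rangle$ with $S\neq\emptyset$, $R\subseteq S\times S$ and $V:\mathbf P\to\mathcal P(S)$, in the usual way for $\top,p,\neg,\wedge$, and by: $\mathcal M,s\vDash\blacktriangle\phi$ iff ($\mathcal M,s\vDash\phi$ implies $\mathcal M,t\vDash\phi$ for all $t$ with $sRt$) and ($\mathcal M,s\nvDash\phi$ implies $\mathcal M,t\nvDash\phi$ for all $t$ with $sRt$). A nonempty relation $Z\subseteq S\times S$ is a $\blacktriangle$-bisimulation on $\mathcal M$ if $sZs'$ implies: (Inv) for all $p\in\mathbf P$, $s\in V(p)$ iff $s'\in V(p)$; (Forth) if $sRt$ and $(s,t)\notin Z$, then there is $t'$ with $s'Rt'$ and $tZt'$; (Back) if $s'Rt'$ and $(s',t')\notin Z$, then there is $t$ with $sRt$ and $tZt'$. Pointed models $(\mathcal M,s)$ and $(\mathcal N,t)$ are $\blacktriangle$-bisimilar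 if there is a $\blacktriangle$-bisimulation $Z$ on the disjoint union of $\mathcal M$ and $\mathcal N$ with $sZt$. Let $\alpha(x)$ be a first-order formula with at most one free variable $x$ in the correspondence language, which has equality, a binary relation symbol for $R$, and a unary predicate symbol for each $p\in\mathbf P$, interpreted in $\mathcal M$ by $V(p)$. Write $\mathcal M,s\vDash\alpha$ if $\alpha$ is true in $\mathcal M$ when $x$ is assigned $s$. Theorem. The following are equivalent: (1) $\alpha$ is equivalent to an $\mathcal L(\blacktriangle)$-formula, i.e. there is $\phi\in\mathcal L(\blacktriangle)$ such that for every pointed model $(\mathcal M,s)$: $\mathcal M,s\vDash\alpha$ iff $\mathcal M,s\vDash\phi$; (2) $\alpha$ is invariant under $\blacktriangle$-bisimulation, i.e. for all pointed models $(\mathcal M,s)$ and $(\mathcal N,t)$ that are $\blacktriangle$-bisimilar: $\mathcal M,s\vDash\alpha$ iff $\mathcal N,t\vDash\alpha$. -/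

import Mathlib

universe u v

namespace StrongNoncontingency

/-- Kripke models over a set `P` of propositional variables: a nonempty set of worlds, an
arbitrary binary accessibility relation, and a valuation. -/
structure KripkeModel (P : Type u) : Type (max u (v + 1)) where
  World : Type v
  nonempty : Nonempty World
  R : World → World → Prop
  V : P → Set World

attribute [instance] KripkeModel.nonempty

/-- The language `L(▲)` of strong noncontingency logic. -/
inductive Formula (P : Type u) : Type u
  | top : Formula P
  | var : P → Formula P
  | neg : Formula P → Formula P
  | and : Formula P → Formula P → Formula P
  | tri : Formula P → Formula P

/-- Truth of an `L(▲)`-formula at a world of a Kripke model. -/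
def Sat {P : Type u} (M : KripkeModel.{u, v} P) (s : M.World) : Formula P → Prop
  | .top => True
  | .var p => s ∈ M.V p
  | .neg φ => ¬ Sat M s φ
  | .and φ ψ => Sat M s φ ∧ Sat M s ψ
  | .tri φ => (Sat M s φ → ∀ t, M.R s t → Sat M t φ) ∧
      (¬ Sat M s φ → ∀ t, M.R s t → ¬ Sat M t φ)

/-- A `▲`-bisimulation on a single model `M`. -/
structure IsTriBisimulation {P : Type u} (M : KripkeModel.{u, v} P)
    (Z : M.World → M.World → Prop) : Prop where
  nonempty : ∃ s s', Z s s'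
  inv : ∀ s s', Z s s' → ∀ p, s ∈ M.V p ↔ s' ∈ M.V p
  forth : ∀ s s', Z s s' → ∀ t, M.R s t → ¬ Z s t → ∃ t', M.R s' t' ∧ Z t t'
  back : ∀ s s', Z s s' → ∀ t', M.R s' t' → ¬ Z s' t' → ∃ t, M.R s t ∧ Z t t'

/-- The disjoint union of two Kripke models. -/
def KripkeModel.disjointUnion {P : Type u} (M N : KripkeModel.{u, v} P) :
    KripkeModel.{u, v} P where
  World := M.World ⊕ N.World
  nonempty := inferInstance
  R := Sum.LiftRel M.R N.R
  V p := Sum.inl '' M.V p ∪ Sum.inr '' N.V p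

/-- Two pointed models are `▲`-bisimilar if their points are linked by a `▲`-bisimulation on the
disjoint union of the two models. -/
def TriBisimilar {P : Type u} (M : KripkeModel.{u, v} P) (s : M.World)
    (N : KripkeModel.{u, v} P) (t : N.World) : Prop :=
  ∃ Z : (M.disjointUnion N).World → (M.disjointUnion N).World → Prop,
    IsTriBisimulation (M.disjointUnion N) Z ∧ Z (Sum.inl s) (Sum.inr t)

/-- Relation symbols of the correspondence language: a unary predicate for every propositional
variable, and one binary relation symbol. -/
inductive CorrRel (P : Type u) : ℕ → Type u
  | pred (p : P) : CorrRel P 1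
  | acc : CorrRel P 2

/-- The first-order correspondence language (equality is a logical symbol). -/
def corrLanguage (P : Type u) : FirstOrder.Language.{0, u} :=
  ⟨fun _ => Empty, CorrRel P⟩

/-- A Kripke model viewed as a first-order structure for the correspondence language. -/
instance KripkeModel.corrStructure {P : Type u} (M : KripkeModel.{u, v} P) :
    (corrLanguage P).Structure M.World where
  funMap f _ := f.elim
  RelMap
    | .pred p, x => x 0 ∈ M.V p
    | .acc, x => M.R (x 0) (x 1)

/-- First-order formulas of the correspondence language with (at most) one free variable. -/
abbrev FOFormula (P : Type u) : Type u :=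
  (corrLanguage P).Formula Unit

/-- Truth of a first-order formula at a pointed model: its free variable is interpreted as the
distinguished world. -/
def FOSat {P : Type u} (M : KripkeModel.{u, v} P) (s : M.World) (α : FOFormula P) : Prop :=
  α.Realize (fun _ => s)

/-- A first-order formula and an `L(▲)`-formula are equivalent if they are true at the same
pointed models. -/
def Equivalent {P : Type u} (α : FOFormula P) (φ : Formula P) : Prop :=
  ∀ (M : KripkeModel.{u, v} P) (s : M.World), FOSat M s α ↔ Sat M s φ

/-- Invariance of a first-order formula under `▲`-bisimulation. -/
def TriInvariant {P : Type u} (α : FOFormula P) : Prop :=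
  ∀ (M : KripkeModel.{u, v} P) (s : M.World) (N : KripkeModel.{u, v} P) (t : N.World),
    TriBisimilar M s N t → (FOSat M s α ↔ FOSat N t α)

end StrongNoncontingency

/-! Formulas are invariant because a successor linked to its own source already agrees with it, and
every other successor is matched. For the converse, only a finite set `F` of variables matters to
`α`, so countably many formulas are relevant. If no formula defined `α`, then for each `n` two
pointed models would agree on the first `n` of these and differ on `α`; otherwise
`exists_formula_of_determined` would yield a definition. By Łoś, ultraproducts of the two sequences
agree on all relevant formulas and still differ on `α`. They are also saturated for successors,
which makes agreement itself a `▲`-bisimulation (`SuccessorSaturated.triBisimilar`), contradicting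
invariance. -/

namespace StrongNoncontingency

open Filter FirstOrder Language

/-! ### Invariance and definability by finitely many formulas -/

section Semantics

variable {P : Type u}

theorem sat_tri_iff (M : KripkeModel.{u, v} P) (s : M.World) (φ : Formula P) :
    Sat M s φ.tri ↔ ∀ t, M.R s t → (Sat M s φ ↔ Sat M t φ) := by
  simp only [Sat]
  constructor
  · rintro ⟨h₁, h₂⟩ t ht
    exact ⟨fun h => h₁ h t ht, fun h => by_contra fun h' => h₂ h' t ht h⟩
  · exact fun h => ⟨fun hs t ht => (h t ht).1 hs, fun hs t ht hφ => hs ((h t ht).2 hφ)⟩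

/-- Truth of `L(▲)`-formulas is preserved along `▲`-bisimulations. -/
theorem IsTriBisimulation.sat_iff {M : KripkeModel.{u, v} P} {Z : M.World → M.World → Prop}
    (hZ : IsTriBisimulation M Z) (φ : Formula P) :
    ∀ s s', Z s s' → (Sat M s φ ↔ Sat M s' φ) := by
  induction φ with
  | top => exact fun _ _ _ => Iff.rfl
  | var p => exact fun s s' h => hZ.inv s s' h p
  | neg φ ih => exact fun s s' h => not_congr (ih s s' h)
  | and φ ψ ih₁ ih₂ => exact fun s s' h => and_congr (ih₁ s s' h) (ih₂ s s' h)
  | tri φ ih =>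
    intro s s' h
    rw [sat_tri_iff, sat_tri_iff]
    constructor
    · intro H t' ht'
      by_cases hz : Z s' t'
      · exact ih _ _ hz
      · obtain ⟨t, ht, htt'⟩ := hZ.back s s' h t' ht' hz
        rw [← ih _ _ h, ← ih _ _ htt']
        exact H t ht
    · intro H t ht
      by_cases hz : Z s t
      · exact ih _ _ hz
      · obtain ⟨t', ht', htt'⟩ := hZ.forth s s' h t ht hz
        rw [ih _ _ h, ih _ _ htt']
        exact H t' ht'

theorem sat_disjointUnion_inl (M N : KripkeModel.{u, v} P) (φ : Formula P) :
    ∀ s : M.World, Sat (M.disjointUnion N) (Sum.inl s) φ ↔ Sat M s φ := by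
  induction φ with
  | top => exact fun _ => Iff.rfl
  | var p =>
    intro s
    change Sum.inl s ∈ Sum.inl '' M.V p ∪ Sum.inr '' N.V p ↔ s ∈ M.V p
    simp
  | neg φ ih => exact fun s => not_congr (ih s)
  | and φ ψ ih₁ ih₂ => exact fun s => and_congr (ih₁ s) (ih₂ s)
  | tri φ ih =>
    intro s
    refine (sat_tri_iff _ _ _).trans (Iff.trans ⟨fun H t ht => ?_, ?_⟩ (sat_tri_iff _ _ _).symm)
    · exact (ih s).symm.trans ((H (Sum.inl t) (Sum.LiftRel.inl ht)).trans (ih t))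
    · rintro H _ (⟨ht⟩ | _)
      exact (ih s).trans ((H _ ht).trans (ih _).symm)

theorem sat_disjointUnion_inr (M N : KripkeModel.{u, v} P) (φ : Formula P) :
    ∀ s : N.World, Sat (M.disjointUnion N) (Sum.inr s) φ ↔ Sat N s φ := by
  induction φ with
  | top => exact fun _ => Iff.rfl
  | var p =>
    intro s
    change Sum.inr s ∈ Sum.inl '' M.V p ∪ Sum.inr '' N.V p ↔ s ∈ N.V p
    simp
  | neg φ ih => exact fun s => not_congr (ih s)
  | and φ ψ ih₁ ih₂ => exact fun s => and_congr (ih₁ s) (ih₂ s)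
  | tri φ ih =>
    intro s
    refine (sat_tri_iff _ _ _).trans (Iff.trans ⟨fun H t ht => ?_, ?_⟩ (sat_tri_iff _ _ _).symm)
    · exact (ih s).symm.trans ((H (Sum.inr t) (Sum.LiftRel.inr ht)).trans (ih t))
    · rintro H _ (_ | ⟨ht⟩)
      exact (ih s).trans ((H _ ht).trans (ih _).symm)

theorem TriBisimilar.sat_iff {M N : KripkeModel.{u, v} P} {s : M.World} {t : N.World}
    (h : TriBisimilar M s N t) (φ : Formula P) : Sat M s φ ↔ Sat N t φ := by
  obtain ⟨Z, hZ, hst⟩ := h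
  rw [← sat_disjointUnion_inl M N, ← sat_disjointUnion_inr M N]
  exact hZ.sat_iff φ _ _ hst

/-- A property of pointed models that depends only on the truth values of finitely many
`L(▲)`-formulas is defined by an `L(▲)`-formula. -/
theorem exists_formula_of_determined (l : List (Formula P))
    (Q : (Σ M : KripkeModel.{u, v} P, M.World) → Prop)
    (hQ : ∀ x y, (∀ φ ∈ l, Sat x.1 x.2 φ ↔ Sat y.1 y.2 φ) → (Q x ↔ Q y)) :
    ∃ ψ : Formula P, ∀ x, Q x ↔ Sat x.1 x.2 ψ := by
  induction l generalizing Q with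
  | nil =>
    by_cases h : ∃ x, Q x
    · obtain ⟨x, hx⟩ := h
      exact ⟨.top, fun y => iff_of_true ((hQ x y (by simp)).1 hx) trivial⟩
    · exact ⟨.neg .top, fun y => iff_of_false (fun hy => h ⟨y, hy⟩) (fun h => h trivial)⟩
  | cons φ l ih =>
    -- Quantifying over some `y` that agrees with `x` on `l` gives a property determined by `l`
    -- alone, so the induction hypothesis applies.
    have key : ∀ b : Prop, ∃ ψ : Formula P, ∀ x : (Σ M : KripkeModel.{u, v} P, M.World),
        (∃ y, (Sat y.1 y.2 φ ↔ b) ∧ (∀ χ ∈ l, Sat x.1 x.2 χ ↔ Sat y.1 y.2 χ) ∧ Q y) ↔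
          Sat x.1 x.2 ψ := by
      intro b
      apply ih
      intro x y hxy
      constructor
      · rintro ⟨z, hz, hxz, hQz⟩
        exact ⟨z, hz, fun χ hχ => (hxy χ hχ).symm.trans (hxz χ hχ), hQz⟩
      · rintro ⟨z, hz, hxz, hQz⟩
        exact ⟨z, hz, fun χ hχ => (hxy χ hχ).trans (hxz χ hχ), hQz⟩
    obtain ⟨ψ₁, h₁⟩ := key True
    obtain ⟨ψ₀, h₀⟩ := key False
    -- Case split on `φ`: the disjunction of `φ ∧ ψ₁` and `¬φ ∧ ψ₀`.
    refine ⟨.neg (.and (.neg (.and φ ψ₁)) (.neg (.and (.neg φ) ψ₀))), fun x => ?_⟩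
    simp only [Sat, ← h₁, ← h₀]
    have back : ∀ y, (Sat x.1 x.2 φ ↔ Sat y.1 y.2 φ) →
        (∀ χ ∈ l, Sat x.1 x.2 χ ↔ Sat y.1 y.2 χ) → Q y → Q x := by
      intro y hy hl hQy
      refine (hQ x y fun χ hχ => ?_).2 hQy
      rcases List.mem_cons.1 hχ with rfl | hχ
      · exact hy
      · exact hl χ hχ
    constructor
    · rintro hx ⟨h, h'⟩
      by_cases hφ : Sat x.1 x.2 φ
      · exact h ⟨hφ, x, by simp [hφ], fun _ _ => Iff.rfl, hx⟩
      · exact h' ⟨hφ, x, by simp [hφ], fun _ _ => Iff.rfl, hx⟩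
    · intro h
      by_contra hx
      refine h ⟨?_, ?_⟩
      · rintro ⟨hφ, y, hy, hl, hQy⟩
        exact hx (back y (by simp_all) hl hQy)
      · rintro ⟨hφ, y, hy, hl, hQy⟩
        exact hx (back y (by simp_all) hl hQy)

end Semantics

/-! ### Saturated models and the bisimulation -/

section Saturation

variable {P : Type u}

/-- Every countable set of formulas that is finitely satisfiable among the successors of a world
is satisfied at one of these successors. -/
def SuccessorSaturated (M : KripkeModel.{u, v} P) : Prop :=
  ∀ (s : M.World) (σ : ℕ → Formula P),
    (∀ n, ∃ t, M.R s t ∧ ∀ i < n, Sat M t (σ i)) → ∃ t, M.R s t ∧ ∀ i, Sat M t (σ i)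

theorem SuccessorSaturated.disjointUnion {M N : KripkeModel.{u, v} P}
    (hM : SuccessorSaturated M) (hN : SuccessorSaturated N) :
    SuccessorSaturated (M.disjointUnion N) := by
  rintro (s | s) σ h
  · obtain ⟨t, ht, hσ⟩ := hM s σ fun n => by
      obtain ⟨_, ⟨ht⟩ | _, hσ⟩ := h n
      exact ⟨_, ht, fun i hi => (sat_disjointUnion_inl M N _ _).1 (hσ i hi)⟩
    exact ⟨Sum.inl t, Sum.LiftRel.inl ht, fun i => (sat_disjointUnion_inl M N _ _).2 (hσ i)⟩
  · obtain ⟨t, ht, hσ⟩ := hN s σ fun n => by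
      obtain ⟨_, _ | ⟨ht⟩, hσ⟩ := h n
      exact ⟨_, ht, fun i hi => (sat_disjointUnion_inr M N _ _).1 (hσ i hi)⟩
    exact ⟨Sum.inr t, Sum.LiftRel.inr ht, fun i => (sat_disjointUnion_inr M N _ _).2 (hσ i)⟩

/-- The successors of a world of a saturated model that are not equivalent to it are matched, up
to equivalence, by successors of any equivalent world. -/
theorem SuccessorSaturated.forth {M : KripkeModel.{u, v} P} (hM : SuccessorSaturated M)
    {Φ : Set (Formula P)} (hΦ : Φ.Countable) (hneg : ∀ φ ∈ Φ, φ.neg ∈ Φ)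
    (hand : ∀ φ ∈ Φ, ∀ ψ ∈ Φ, φ.and ψ ∈ Φ) (htri : ∀ φ ∈ Φ, φ.tri ∈ Φ)
    {s s' t : M.World} (hss' : ∀ φ ∈ Φ, Sat M s φ ↔ Sat M s' φ) (hst : M.R s t)
    (hne : ¬ ∀ φ ∈ Φ, Sat M s φ ↔ Sat M t φ) :
    ∃ t', M.R s' t' ∧ ∀ φ ∈ Φ, Sat M t φ ↔ Sat M t' φ := by
  classical
  push Not at hne
  -- Closure under negation lets the distinguishing formula be true at `t` and false at `s`.
  have hχ : ∃ χ ∈ Φ, Sat M t χ ∧ ¬ Sat M s χ := by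
    obtain ⟨χ, hχ, h⟩ := hne
    by_cases hs : Sat M s χ
    · exact ⟨χ.neg, hneg χ hχ, by simp_all [Sat]⟩
    · exact ⟨χ, hχ, by simp_all⟩
  obtain ⟨χ, hχ, hχt, hχs⟩ := hχ
  obtain ⟨e, rfl⟩ := hΦ.exists_eq_range ⟨χ, hχ⟩
  let σ : ℕ → Formula P := fun i => if Sat M t (e i) then e i else (e i).neg
  have hσ : ∀ i, σ i ∈ Set.range e ∧ Sat M t (σ i) := by
    intro i
    by_cases h : Sat M t (e i)
    · simp only [σ, if_pos h]
      exact ⟨⟨i, rfl⟩, h⟩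
    · simp only [σ, if_neg h]
      exact ⟨hneg _ ⟨i, rfl⟩, h⟩
  -- Keeping `χ` as a conjunct makes each finite part of the theory of `t` false at `s`.
  have hδ : ∀ n, ∃ δ ∈ Set.range e, Sat M t δ ∧ ¬ Sat M s δ ∧
      ∀ x, Sat M x δ → ∀ i < n, Sat M x (σ i) := by
    intro n
    induction n with
    | zero => exact ⟨χ, hχ, hχt, hχs, by simp⟩
    | succ n ih =>
      obtain ⟨δ, hmem, ht, hs, himp⟩ := ih
      refine ⟨δ.and (σ n), hand _ hmem _ (hσ n).1, ⟨ht, (hσ n).2⟩, fun h => hs h.1, ?_⟩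
      intro x hx i hi
      rcases Nat.lt_succ_iff_lt_or_eq.1 hi with hi | rfl
      · exact himp x hx.1 i hi
      · exact hx.2
  obtain ⟨t', ht', hall⟩ := hM s' σ fun n => by
    obtain ⟨δ, hmem, ht, hs, himp⟩ := hδ n
    -- The successor `t` refutes `▲δ` at `s`, hence it fails at `s'`. Since `δ` is false at `s'`,
    -- some successor of `s'` satisfies `δ`.
    have htri' : ¬ Sat M s' δ.tri := by
      rw [← hss' _ (htri _ hmem), sat_tri_iff]
      exact fun h => hs ((h t hst).2 ht)
    have hs' : ¬ Sat M s' δ := fun h => hs ((hss' _ hmem).2 h)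
    rw [sat_tri_iff] at htri'
    push Not at htri'
    obtain ⟨t', ht', h⟩ := htri'
    exact ⟨t', ht', himp t' (by simp_all)⟩
  refine ⟨t', ht', ?_⟩
  rintro _ ⟨i, rfl⟩
  have := hall i
  by_cases h : Sat M t (e i)
  · simp only [σ, if_pos h] at this
    exact iff_of_true h this
  · simp only [σ, if_neg h] at this
    exact iff_of_false h this

/-- Equivalence with respect to a suitable countable set of formulas is a `▲`-bisimulation between
saturated models. -/
theorem SuccessorSaturated.triBisimilar {M N : KripkeModel.{u, v} P}
    (hM : SuccessorSaturated M) (hN : SuccessorSaturated N)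
    {Φ : Set (Formula P)} (hΦ : Φ.Countable) (hneg : ∀ φ ∈ Φ, φ.neg ∈ Φ)
    (hand : ∀ φ ∈ Φ, ∀ ψ ∈ Φ, φ.and ψ ∈ Φ) (htri : ∀ φ ∈ Φ, φ.tri ∈ Φ)
    (hvar : ∀ p, .var p ∈ Φ ∨ M.V p = ∅ ∧ N.V p = ∅)
    {s : M.World} {t : N.World} (hst : ∀ φ ∈ Φ, Sat M s φ ↔ Sat N t φ) :
    TriBisimilar M s N t := by
  have hD := hM.disjointUnion hN
  have hst' : ∀ φ ∈ Φ,
      Sat (M.disjointUnion N) (Sum.inl s) φ ↔ Sat (M.disjointUnion N) (Sum.inr t) φ := by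
    intro φ hφ
    rw [sat_disjointUnion_inl, sat_disjointUnion_inr]
    exact hst φ hφ
  refine ⟨fun x y => ∀ φ ∈ Φ, Sat (M.disjointUnion N) x φ ↔ Sat (M.disjointUnion N) y φ,
    ⟨⟨_, _, hst'⟩, ?_, ?_, ?_⟩, hst'⟩
  · intro x y h p
    rcases hvar p with hp | ⟨h₁, h₂⟩
    · exact h _ hp
    · have hV : (M.disjointUnion N).V p = ∅ := by
        change Sum.inl '' M.V p ∪ Sum.inr '' N.V p = ∅
        rw [h₁, h₂, Set.image_empty, Set.image_empty, Set.union_empty]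
      rw [hV]
      exact Iff.rfl
  · exact fun x y h t ht hne => hD.forth hΦ hneg hand htri h ht hne
  · intro x y h t' ht' hne
    obtain ⟨t, ht, h'⟩ := hD.forth hΦ hneg hand htri (fun φ hφ => (h φ hφ).symm) ht' hne
    exact ⟨t, ht, fun φ hφ => (h' φ hφ).symm⟩

end Saturation

/-! ### Ultraproducts, Łoś's theorem and saturation -/

section Ultraproduct

variable {P : Type u}

/-- The ultraproduct of a sequence of Kripke models along a nonprincipal ultrafilter. -/
noncomputable def KripkeModel.ultraproduct (M : ℕ → KripkeModel.{u, v} P) : KripkeModel.{u, v} P where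
  World := (hyperfilter ℕ : Filter ℕ).Product fun n => (M n).World
  nonempty := inferInstance
  R x y := Structure.RelMap (L := corrLanguage P) CorrRel.acc ![x, y]
  V p := {x | Structure.RelMap (L := corrLanguage P) (CorrRel.pred p) ![x]}

/-- The world of the ultraproduct represented by a sequence of worlds. -/
noncomputable def KripkeModel.ultraMk {M : ℕ → KripkeModel.{u, v} P} (f : ∀ n, (M n).World) :
    (KripkeModel.ultraproduct M).World :=
  Quotient.mk ((hyperfilter ℕ : Filter ℕ).productSetoid fun n => (M n).World) f

open KripkeModel (ultraproduct ultraMk)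

variable {M : ℕ → KripkeModel.{u, v} P}

theorem exists_ultraMk_eq (x : (ultraproduct M).World) : ∃ f, ultraMk f = x :=
  Quotient.exists_rep x

theorem ultraproduct_R_ultraMk (f g : ∀ n, (M n).World) :
    (ultraproduct M).R (ultraMk f) (ultraMk g) ↔ ∀ᶠ n in hyperfilter ℕ, (M n).R (f n) (g n) := by
  let := Ultraproduct.setoidPrestructure (L := corrLanguage P) (fun n => (M n).World)
    (hyperfilter ℕ)
  have h := relMap_quotient_mk' (L := corrLanguage P)
    ((hyperfilter ℕ : Filter ℕ).productSetoid fun n => (M n).World) (CorrRel.acc) ![f, g]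
  refine Iff.trans (iff_of_eq ?_) h
  simp only [ultraproduct]
  congr 1
  funext i
  fin_cases i <;> rfl

theorem mem_V_ultraMk (f : ∀ n, (M n).World) (p : P) :
    ultraMk f ∈ (ultraproduct M).V p ↔ ∀ᶠ n in hyperfilter ℕ, f n ∈ (M n).V p := by
  let := Ultraproduct.setoidPrestructure (L := corrLanguage P) (fun n => (M n).World)
    (hyperfilter ℕ)
  have h := relMap_quotient_mk' (L := corrLanguage P)
    ((hyperfilter ℕ : Filter ℕ).productSetoid fun n => (M n).World) (CorrRel.pred p) ![f]
  refine Iff.trans (iff_of_eq ?_) h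
  simp only [ultraproduct]
  congr 1

theorem corrStructure_ultraproduct :
    KripkeModel.corrStructure (ultraproduct M) =
      Ultraproduct.structure (L := corrLanguage P) (u := hyperfilter ℕ)
        (M := fun n => (M n).World) := by
  refine Structure.ext ?_ ?_
  · funext n f
    exact f.elim
  · funext n r x
    cases r with
    | pred p =>
      have : x = ![x 0] := by funext i; fin_cases i; rfl
      rw [this]; rfl
    | acc =>
      have : x = ![x 0, x 1] := by funext i; fin_cases i <;> rfl
      rw [this]; rfl

/-- Łoś's theorem for the correspondence language. -/
theorem foSat_ultraMk (f : ∀ n, (M n).World) (α : FOFormula P) :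
    FOSat (ultraproduct M) (ultraMk f) α ↔ ∀ᶠ n in hyperfilter ℕ, FOSat (M n) (f n) α := by
  refine Iff.trans ?_ (Ultraproduct.realize_formula_cast (L := corrLanguage P)
    (u := hyperfilter ℕ) (M := fun n => (M n).World) α fun _ => f)
  unfold FOSat
  rw [corrStructure_ultraproduct]
  rfl

/-- Łoś's theorem for `L(▲)`. -/
theorem sat_ultraMk (φ : Formula P) : ∀ f : ∀ n, (M n).World,
    Sat (ultraproduct M) (ultraMk f) φ ↔ ∀ᶠ n in hyperfilter ℕ, Sat (M n) (f n) φ := by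
  induction φ with
  | top => intro f; simp [Sat]
  | var p => exact fun f => mem_V_ultraMk f p
  | neg φ ih =>
    intro f
    simp only [Sat, ih]
    exact Ultrafilter.eventually_not.symm
  | and φ ψ ih₁ ih₂ =>
    intro f
    simp only [Sat, ih₁, ih₂]
    exact eventually_and.symm
  | tri φ ih =>
    intro f
    simp only [sat_tri_iff]
    constructor
    · intro H
      by_contra hn
      rw [← Ultrafilter.eventually_not] at hn
      -- A counterexample successor at each bad index; `f n` is a dummy elsewhere.
      have : ∀ n, ∃ t, (¬ ∀ t, (M n).R (f n) t → (Sat (M n) (f n) φ ↔ Sat (M n) t φ)) →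
          (M n).R (f n) t ∧ ¬ (Sat (M n) (f n) φ ↔ Sat (M n) t φ) := by
        intro n
        by_cases h : ∀ t, (M n).R (f n) t → (Sat (M n) (f n) φ ↔ Sat (M n) t φ)
        · exact ⟨f n, fun h' => (h' h).elim⟩
        · push Not at h
          obtain ⟨t, ht, h⟩ := h
          exact ⟨t, fun _ => ⟨ht, by tauto⟩⟩
      choose g hg using this
      have hR := H (ultraMk g) ((ultraproduct_R_ultraMk f g).2 (hn.mono fun n h => (hg n h).1))
      rw [ih, ih] at hR
      have hne := hn.mono fun n h => (hg n h).2
      by_cases hf : ∀ᶠ n in hyperfilter ℕ, Sat (M n) (f n) φ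
      · obtain ⟨n, h₁, h₂, h₃⟩ := (hf.and ((hR.1 hf).and hne)).exists
        exact h₃ (iff_of_true h₁ h₂)
      · have hg' := Ultrafilter.eventually_not.2 (fun h => hf (hR.2 h))
        obtain ⟨n, h₁, h₂, h₃⟩ := ((Ultrafilter.eventually_not.2 hf).and (hg'.and hne)).exists
        exact h₃ (iff_of_false h₁ h₂)
    · intro H t ht
      obtain ⟨g, rfl⟩ := exists_ultraMk_eq t
      rw [ih, ih]
      exact eventually_congr ((H.and ((ultraproduct_R_ultraMk f g).1 ht)).mono fun n h => h.1 _ h.2)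

/-- Diagonal argument: at index `k`, pick a successor satisfying the longest initial segment of `σ`
of length at most `k`. For each `i`, this length exceeds `i` at almost all `k`. -/
theorem successorSaturated_ultraproduct (M : ℕ → KripkeModel.{u, v} P) :
    SuccessorSaturated (ultraproduct M) := by
  classical
  intro s σ h
  obtain ⟨f, rfl⟩ := exists_ultraMk_eq s
  let X : ℕ → ℕ → Prop := fun k n => ∃ t, (M k).R (f k) t ∧ ∀ i < n, Sat (M k) t (σ i)
  have hX : ∀ n, ∀ᶠ k in hyperfilter ℕ, X k n := by
    intro n
    obtain ⟨t, ht, hσ⟩ := h n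
    obtain ⟨g, rfl⟩ := exists_ultraMk_eq t
    have : ∀ᶠ k in hyperfilter ℕ, ∀ i ∈ Set.Iio n, Sat (M k) (g k) (σ i) :=
      (eventually_all_finite (Set.finite_Iio n)).2 fun i hi => (sat_ultraMk _ _).1 (hσ i hi)
    exact (((ultraproduct_R_ultraMk f g).1 ht).and this).mono fun k hk => ⟨g k, hk⟩
  have hg : ∀ k, ∃ t, X k (Nat.findGreatest (X k) k) →
      (M k).R (f k) t ∧ ∀ i < Nat.findGreatest (X k) k, Sat (M k) t (σ i) := by
    intro k
    by_cases hk : X k (Nat.findGreatest (X k) k)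
    · exact hk.imp fun t ht _ => ht
    · exact ⟨f k, fun h => (hk h).elim⟩
  choose g hg using hg
  have hgood : ∀ᶠ k in hyperfilter ℕ, X k (Nat.findGreatest (X k) k) :=
    (hX 0).mono fun k hk => Nat.findGreatest_spec (Nat.zero_le k) hk
  refine ⟨ultraMk g, (ultraproduct_R_ultraMk f g).2 (hgood.mono fun k hk => (hg k hk).1), fun i => ?_⟩
  rw [sat_ultraMk]
  have hlarge : ∀ᶠ k in hyperfilter ℕ, i + 1 ≤ k :=
    (eventually_ge_atTop (i + 1)).filter_mono Nat.hyperfilter_le_atTop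
  refine (hgood.and (hlarge.and (hX (i + 1)))).mono fun k ⟨h₁, h₂, h₃⟩ => ?_
  exact (hg k h₁).2 i (Nat.lt_of_succ_le (Nat.le_findGreatest h₂ h₃))

end Ultraproduct

/-! ### Reduction to finitely many variables -/

section FinitelyManyVariables

variable {P : Type u}

/-- Renaming of propositional variables. -/
def Formula.map {Q : Type*} (f : Q → P) : Formula Q → Formula P
  | .top => .top
  | .var q => .var (f q)
  | .neg φ => .neg (φ.map f)
  | .and φ ψ => .and (φ.map f) (ψ.map f)
  | .tri φ => .tri (φ.map f)

/-- A Gödel numbering of the formulas over an encodable set of variables. -/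
def Formula.code [Encodable P] : Formula P → ℕ
  | .top => 0
  | .var p => 4 * Encodable.encode p + 1
  | .neg φ => 4 * φ.code + 2
  | .and φ ψ => 4 * Nat.pair φ.code ψ.code + 3
  | .tri φ => 4 * φ.code + 4

/-- Residues mod 4 separate the constructors, except `top` and `tri`, where only `top` has code
zero. -/
theorem Formula.code_injective [Encodable P] :
    Function.Injective (Formula.code : Formula P → ℕ) := by
  intro φ
  induction φ with
  | top => intro ψ h; cases ψ <;> simp only [Formula.code] at h <;> first | rfl | omega
  | var p =>
    intro ψ h
    cases ψ <;> simp only [Formula.code] at h <;> try omega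
    exact congr_arg _ (Encodable.encode_injective (by omega))
  | neg φ ih =>
    intro ψ h
    cases ψ <;> simp only [Formula.code] at h <;> try omega
    exact congr_arg _ (ih (by omega))
  | and φ₁ φ₂ ih₁ ih₂ =>
    intro ψ h
    cases ψ <;> simp only [Formula.code] at h <;> try omega
    have h' := Nat.pair_eq_pair.1 (Nat.eq_of_mul_eq_mul_left four_pos (Nat.add_right_cancel h))
    exact congr_arg₂ _ (ih₁ h'.1) (ih₂ h'.2)
  | tri φ ih =>
    intro ψ h
    cases ψ <;> simp only [Formula.code] at h <;> try omega
    exact congr_arg _ (ih (by omega))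

theorem Formula.countable [Countable P] : Countable (Formula P) := by
  have := Encodable.ofCountable P
  exact Formula.code_injective.countable

/-- The model in which all variables outside `F` are made false everywhere. -/
def KripkeModel.restrict (F : Finset P) (M : KripkeModel.{u, v} P) : KripkeModel.{u, v} P where
  World := M.World
  nonempty := M.nonempty
  R := M.R
  V p := {x | p ∈ F ∧ x ∈ M.V p}

theorem sat_restrict_map (F : Finset P) (M : KripkeModel.{u, v} P)
    (φ : Formula {p // p ∈ F}) : ∀ s : M.World,
    Sat (M.restrict F) s (φ.map Subtype.val) ↔ Sat M s (φ.map Subtype.val) := by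
  induction φ with
  | top => exact fun _ => Iff.rfl
  | var p => exact fun s => and_iff_right p.2
  | neg φ ih => exact fun s => not_congr (ih s)
  | and φ ψ ih₁ ih₂ => exact fun s => and_congr (ih₁ s) (ih₂ s)
  | tri φ ih =>
    intro s
    refine (sat_tri_iff _ _ _).trans (Iff.trans ?_ (sat_tri_iff _ _ _).symm)
    exact forall_congr' fun t => imp_congr Iff.rfl (iff_congr (ih s) (ih t))

theorem realize_term_restrict (F : Finset P) (M : KripkeModel.{u, v} P) {β : Type*}
    (t : (corrLanguage P).Term β) (w : β → M.World) :
    @Term.realize _ _ (M.restrict F).corrStructure β w t = t.realize w := by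
  cases t with
  | var => rfl
  | func f => exact f.elim

/-- Allowing every `F ⊇ F₀` lets the sets for the two sides of an implication be merged. -/
theorem exists_finset_realize_restrict {β : Type*} {n : ℕ}
    (α : (corrLanguage P).BoundedFormula β n) :
    ∃ F₀ : Finset P, ∀ F, F₀ ⊆ F → ∀ (M : KripkeModel.{u, v} P) (w : β → M.World)
      (x : Fin n → M.World),
      @BoundedFormula.Realize _ _ (M.restrict F).corrStructure _ _ α w x ↔ α.Realize w x := by
  classical
  induction α with
  | falsum => exact ⟨∅, fun _ _ _ _ _ => Iff.rfl⟩
  | equal t₁ t₂ =>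
    refine ⟨∅, fun F _ M w x => ?_⟩
    simp only [BoundedFormula.Realize]
    exact iff_of_eq (congr_arg₂ _ (realize_term_restrict F M t₁ _)
      (realize_term_restrict F M t₂ _))
  | rel r ts =>
    cases r with
    | pred p =>
      refine ⟨{p}, fun F hF M w x => ?_⟩
      have hp : p ∈ F := hF (Finset.mem_singleton_self p)
      refine (and_iff_right hp).trans (iff_of_eq ?_)
      exact congr_arg (· ∈ M.V p) (realize_term_restrict F M (ts 0) _)
    | acc =>
      refine ⟨∅, fun F _ M w x => iff_of_eq ?_⟩
      exact congr_arg₂ M.R (realize_term_restrict F M (ts 0) _)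
        (realize_term_restrict F M (ts 1) _)
  | imp α₁ α₂ ih₁ ih₂ =>
    obtain ⟨F₁, h₁⟩ := ih₁
    obtain ⟨F₂, h₂⟩ := ih₂
    refine ⟨F₁ ∪ F₂, fun F hF M w x => ?_⟩
    exact imp_congr (h₁ F (Finset.union_subset_left hF) M w x)
      (h₂ F (Finset.union_subset_right hF) M w x)
  | all α ih =>
    obtain ⟨F₀, h⟩ := ih
    exact ⟨F₀, fun F hF M w x => forall_congr' fun a => h F hF M w (Fin.snoc x a)⟩

theorem exists_finset_foSat_restrict (α : FOFormula P) :
    ∃ F : Finset P, ∀ (M : KripkeModel.{u, v} P) (s : M.World),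
      FOSat (M.restrict F) s α ↔ FOSat M s α := by
  obtain ⟨F, h⟩ := exists_finset_realize_restrict.{u, v} α
  exact ⟨F, fun M s => h F subset_rfl M _ _⟩

end FinitelyManyVariables

/-! ### The characterization theorem -/

theorem exists_equivalent_of_triInvariant {P : Type u} (α : FOFormula P)
    (hα : TriInvariant.{u, v} α) : ∃ φ : Formula P, Equivalent.{u, v} α φ := by
  obtain ⟨F, hF⟩ := exists_finset_foSat_restrict.{u, v} α
  have : Countable (Formula {p // p ∈ F}) := Formula.countable
  obtain ⟨e, he⟩ := (Set.countable_range
    (Formula.map (Subtype.val : {p // p ∈ F} → P))).exists_eq_range ⟨_, .top, rfl⟩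
  have hsat : ∀ i (M : KripkeModel.{u, v} P) (s : M.World),
      Sat (M.restrict F) s (e i) ↔ Sat M s (e i) := by
    intro i M s
    obtain ⟨φ, hφ⟩ : e i ∈ Set.range (Formula.map (Subtype.val : {p // p ∈ F} → P)) :=
      he ▸ ⟨i, rfl⟩
    rw [← hφ]
    exact sat_restrict_map F M φ s
  by_contra hno
  have key : ∀ n : ℕ, ∃ x y : (Σ M : KripkeModel.{u, v} P, M.World),
      (∀ i < n, Sat x.1 x.2 (e i) ↔ Sat y.1 y.2 (e i)) ∧
        FOSat x.1 x.2 α ∧ ¬ FOSat y.1 y.2 α := by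
    intro n
    by_contra hn
    push Not at hn
    obtain ⟨ψ, hψ⟩ := exists_formula_of_determined ((List.range n).map e)
      (fun x => FOSat x.1 x.2 α) fun x y hxy => by
        have hxy' : ∀ i < n, Sat x.1 x.2 (e i) ↔ Sat y.1 y.2 (e i) := fun i hi =>
          hxy _ (List.mem_map.2 ⟨i, List.mem_range.2 hi, rfl⟩)
        exact ⟨hn x y hxy', hn y x fun i hi => (hxy' i hi).symm⟩
    exact hno ⟨ψ, fun M s => hψ ⟨M, s⟩⟩
  choose x y hxy hx hy using key
  let M := fun n => (x n).1.restrict F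
  let N := fun n => (y n).1.restrict F
  let s : (KripkeModel.ultraproduct M).World :=
    KripkeModel.ultraMk (M := M) fun n => (x n).2
  let t : (KripkeModel.ultraproduct N).World :=
    KripkeModel.ultraMk (M := N) fun n => (y n).2
  have hs : FOSat _ s α :=
    (foSat_ultraMk (M := M) _ α).2 (Eventually.of_forall fun n => (hF _ _).2 (hx n))
  have ht : ¬ FOSat _ t α := fun h => by
    obtain ⟨n, hn⟩ := ((foSat_ultraMk (M := N) _ α).1 h).exists
    exact hy n ((hF _ _).1 hn)
  -- Restricting the factors makes variables outside `F` false throughout the ultraproduct, so (Inv)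
  -- holds for them too.
  have hempty : ∀ (K : ℕ → KripkeModel.{u, v} P) (p : P), p ∉ F →
      (KripkeModel.ultraproduct fun n => (K n).restrict F).V p = ∅ := by
    intro K p hp
    refine Set.eq_empty_of_forall_notMem fun z hz => ?_
    obtain ⟨f, rfl⟩ := exists_ultraMk_eq z
    obtain ⟨n, hn⟩ := ((mem_V_ultraMk f p).1 hz).exists
    exact hp hn.1
  refine ht ((hα _ s _ t ?_).1 hs)
  refine (successorSaturated_ultraproduct M).triBisimilar (successorSaturated_ultraproduct N)
    (Set.countable_range (Formula.map (Subtype.val : {p // p ∈ F} → P))) ?_ ?_ ?_ ?_ ?_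
  · rintro _ ⟨φ, rfl⟩
    exact ⟨φ.neg, rfl⟩
  · rintro _ ⟨φ, rfl⟩ _ ⟨ψ, rfl⟩
    exact ⟨φ.and ψ, rfl⟩
  · rintro _ ⟨φ, rfl⟩
    exact ⟨φ.tri, rfl⟩
  · intro p
    by_cases hp : p ∈ F
    · exact Or.inl ⟨.var ⟨p, hp⟩, rfl⟩
    · exact Or.inr ⟨hempty _ p hp, hempty _ p hp⟩
  · rw [he]
    rintro _ ⟨i, rfl⟩
    refine (sat_ultraMk (M := M) _ _).trans (Iff.trans ?_ (sat_ultraMk (M := N) _ _).symm)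
    -- The pair at stage `n` agrees on `e i` once `n > i`, thus at almost all indices.
    refine eventually_congr (((eventually_gt_atTop i).filter_mono
      Nat.hyperfilter_le_atTop).mono fun n hn => ?_)
    exact (hsat i _ _).trans ((hxy n i hn).trans (hsat i _ _).symm)

end StrongNoncontingency

theorem mainTheorem3 {P : Type u} (α : StrongNoncontingency.FOFormula P) :
    (∃ φ : StrongNoncontingency.Formula P,
        StrongNoncontingency.Equivalent.{u, max u v} α φ) ↔
      StrongNoncontingency.TriInvariant.{u, max u v} α := by
  constructor
  · rintro ⟨φ, hφ⟩ M s N t h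
    rw [hφ, hφ]
    exact h.sat_iff φ
  · exact StrongNoncontingency.exists_equivalent_of_triInvariant α
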